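/- A \emph{$d$-polytope} is the convex hull of a finite set of points in some $\mathbb{R}^m$ whose affine hull has dimension $d$. Its \emph{face lattice} is the set of all its faces, including the empty face (of dimension $-1$) and the polytope itself, ordered by inclusion. A finite poset is \emph{graded of rank $n$} if all its maximal chains have length $n$; an element of rank $k+1$ is said to have \emph{dimension} $k$. A graded finite poset is \emph{Eulerian} if every interval $[x,y]$ with $x<y$ has as many elements of even rank as of odd rank (a least or greatest element is not required by the definition). We say that a graded poset $Q$ \emph{differs} from the face lattice of $P$ \emph{only in dimensions $j$ and $j+1$} if, after deleting the elements of dimensions $j$ and $j+1$ from both, there is a dimension-preserving order isomorphism between the remaining posets. Let $P$ be a $d$-polytope with $d\ge 3$, and let $j$ be an integer with $0\le j\le d-1$. Then there exists an Eulerian poset $Q$ of rank $d+1$ which is not isomorphic to the face lattice of $P$, but which differs from the face lattice of $P$ only in dimensions $j$ and $j+1$. Moreover, $Q$ can be chosen with a least element, with a greatest element if $j\le d-2$, and of the following form, for some $j$-face $F$ of $P$ and some $(j+1)$-face $G$ of $P$ containing $F$: $Q$ consists of the face lattice of $P$, with its order and its dimensions, and of four further distinct elements $A_1,A_2$ of dimension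 $j$ and $B_1,B_2$ of dimension $j+1$, where for all $i,\ell\in\{1,2\}$ the elements strictly below $A_i$ are the proper faces of $F$ (including the empty face), the elements strictly below $B_\ell$ are $A_1,A_2$ and the proper faces of $F$, the elements strictly above $B_\ell$ are the faces of $P$ properly containing $G$, and the elements strictly above $A_i$ are $B_1,B_2$ and the faces of $P$ properly containing $G$. -/

import Mathlib

/-- A (convex) polytope: the convex hull of a finite set of points. -/
def IsPolytope {V : Type*} [AddCommGroup V] [Module ℝ V] (P : Set V) : Prop :=
  ∃ s : Set V, s.Finite ∧ P = convexHull ℝ s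

open Classical in
/-- The affine dimension of a set; the empty set has dimension `-1`. -/
noncomputable def affDim {V : Type*} [AddCommGroup V] [Module ℝ V] (S : Set V) : ℤ :=
  if S.Nonempty then (Module.finrank ℝ (vectorSpan ℝ S) : ℤ) else -1

/-- A `d`-polytope: a polytope of affine dimension `d`. -/
def IsPolytopeOfDim {V : Type*} [AddCommGroup V] [Module ℝ V] (d : ℕ) (P : Set V) : Prop :=
  IsPolytope P ∧ affDim P = d

/-- The face lattice of `P`, ordered by inclusion. Its elements are the sets of maximizers on `P` of
linear functionals, together with the empty face (`IsExposed ℝ P ∅` always holds); the zero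
functional gives the face `P` itself. -/
abbrev FaceLattice {V : Type*} [AddCommGroup V] [Module ℝ V] [TopologicalSpace V]
    (P : Set V) : Type _ :=
  {F : Set V // IsExposed ℝ P F}

/-- A finite poset `Q`, graded of rank `n` (an instance of `GradeBoundedOrder (Fin (n + 1)) Q`: the
rank increases by one along coverings, minimal elements have rank `0` and maximal elements have
rank `n`, that is, all maximal chains have length `n`), is Eulerian if every interval `[x, y]` with
`x < y` has as many elements of even rank as elements of odd rank. -/
def IsEulerian (n : ℕ) (Q : Type*) [PartialOrder Q] [Finite Q]
    [GradeBoundedOrder (Fin (n + 1)) Q] : Prop :=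
  ∀ x y : Q, x < y →
    {z : Q | z ∈ Set.Icc x y ∧ Even (grade (Fin (n + 1)) z : ℕ)}.ncard =
      {z : Q | z ∈ Set.Icc x y ∧ Odd (grade (Fin (n + 1)) z : ℕ)}.ncard

/-- In a graded poset of rank `n`, the elements of rank `k + 1` are said to have dimension `k`. -/
def elemDim (n : ℕ) {Q : Type*} [PartialOrder Q] [GradeBoundedOrder (Fin (n + 1)) Q]
    (x : Q) : ℤ :=
  ((grade (Fin (n + 1)) x : ℕ) : ℤ) - 1

/-- The graded poset `Q` of rank `n` differs from the face lattice of `P` only in the dimensions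
belonging to `J`: there is a dimension-preserving order isomorphism between what remains of the two
posets when all elements whose dimension is in `J` are deleted. -/
def DiffersOnlyInDims {V : Type*} [AddCommGroup V] [Module ℝ V] [TopologicalSpace V]
    (P : Set V) (n : ℕ) (Q : Type*) [PartialOrder Q] [GradeBoundedOrder (Fin (n + 1)) Q]
    (J : Set ℤ) : Prop :=
  ∃ e : {F : FaceLattice P // affDim F.1 ∉ J} ≃o {x : Q // elemDim n x ∉ J},
    ∀ F, elemDim n (e F).1 = affDim F.1.1

/-- `Q` arises from the face lattice of `P`, embedded by `ι` with its order, by adjoining four new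
elements `A 0`, `A 1`, `B 0`, `B 1`, placed above the proper faces of `F` and below the faces properly
containing `G`, with each `A i` below each `B l`, and with no other new relations. -/
structure AdjoinsFour {V : Type*} [AddCommGroup V] [Module ℝ V] [TopologicalSpace V]
    {P : Set V} {Q : Type*} [PartialOrder Q] (ι : FaceLattice P ↪o Q)
    (F G : FaceLattice P) (A B : Fin 2 → Q) : Prop where
  bijective : Function.Bijective (Sum.elim ι (Sum.elim A B))
  lt_A : ∀ i x, x < A i ↔ ∃ C, C < F ∧ x = ι C
  A_lt : ∀ i x, A i < x ↔ (∃ l, x = B l) ∨ ∃ D, G < D ∧ x = ι D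
  lt_B : ∀ l x, x < B l ↔ (∃ i, x = A i) ∨ ∃ C, C < F ∧ x = ι C
  B_lt : ∀ l x, B l < x ↔ ∃ D, G < D ∧ x = ι D

/-! Adjoin to the face lattice a block of four elements, each `A i` below each `B l`, beside a
covering pair of faces `F` ⋖ `G` of dimensions `j` and `j + 1`. An interval between two old elements
contains all four or none, and the block contributes `2 - 2 = 0` up to sign. An interval ending in
`A i` is one ending in `F` with its top replaced. One ending in `B l` has old part `[x, F)`, whose
alternating sum is minus the sign of `F`; the two `A i` and the single `B l` add twice that sign and
minus it, giving zero. Intervals starting at a new element are dual. Finiteness rules out an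
isomorphism, since four elements were added.

The substantial input is that the face lattice is Eulerian and graded by dimension. Placing the
polytope at height one turns faces into zero sets of linear functionals that are nonnegative on
finitely many vectors. For these, the Euler relation is a valuation argument in the dual space:
`signRealizable_cut` says that cutting a cell by a hyperplane preserves the sum of codimension
signs, and `sum_powerset_rankSign_eq_zero` deduces by induction that the sum vanishes for a
half-open cone. Gradedness is `IsFaceSet.exists_between`. -/

/-! ### Cells of hyperplane arrangements in the dual space -/

section SignPatterns

variable {V : Type*} [AddCommGroup V] [Module ℝ V]

/-- Some linear functional vanishes on `K`, is positive on `A` and negative on `N`. -/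
def SignRealizable (K A N : Finset V) : Prop :=
  ∃ g : Module.Dual ℝ V, (∀ v ∈ K, g v = 0) ∧ (∀ v ∈ A, 0 < g v) ∧ ∀ v ∈ N, g v < 0

/-- The sign `(-1) ^ r`, where `r` is the rank of the finite set `K` of vectors. -/
noncomputable def rankSign (K : Finset V) : ℤ :=
  (-1) ^ Module.finrank ℝ (Submodule.span ℝ (K : Set V))

theorem eq_zero_of_mem_span {K : Set V} {g : Module.Dual ℝ V} (hg : ∀ v ∈ K, g v = 0)
    {x : V} (hx : x ∈ Submodule.span ℝ K) : g x = 0 :=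
  (Submodule.span_le (p := LinearMap.ker g)).2 hg hx

/-- A functional that is positive on a finite set stays positive under small perturbations. -/
theorem exists_pos_perturb (T : Finset V) (f h : Module.Dual ℝ V) (hf : ∀ v ∈ T, 0 < f v) :
    ∃ ε : ℝ, 0 < ε ∧ ∀ v ∈ T, 0 < f v + ε * h v := by
  have h1 : ∀ᶠ ε : ℝ in nhdsWithin 0 (Set.Ioi 0), ∀ v ∈ T, 0 < f v + ε * h v := by
    refine (Filter.eventually_all_finset T).2 fun v hv => ?_
    have : Filter.Tendsto (fun ε : ℝ => f v + ε * h v) (nhds 0) (nhds (f v + 0 * h v)) :=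
      Continuous.tendsto (by fun_prop) 0
    rw [zero_mul, add_zero] at this
    exact (this.mono_left nhdsWithin_le_nhds).eventually (lt_mem_nhds (hf v hv))
  obtain ⟨ε, h2, h3⟩ := (h1.and self_mem_nhdsWithin).exists
  exact ⟨ε, h3, h2⟩

/-- A functional vanishing on `K` can be perturbed within the functionals vanishing on `K` while
keeping its finitely many nonzero signs. -/
theorem SignRealizable.exists_perturb {K A N : Finset V} {g : Module.Dual ℝ V}
    (hK : ∀ v ∈ K, g v = 0) (hA : ∀ v ∈ A, 0 < g v) (hN : ∀ v ∈ N, g v < 0)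
    {h : Module.Dual ℝ V} (hh : ∀ v ∈ K, h v = 0) :
    ∃ ε : ℝ, 0 < ε ∧ (∀ v ∈ K, (g + ε • h) v = 0) ∧ (∀ v ∈ A, 0 < (g + ε • h) v) ∧
      ∀ v ∈ N, (g + ε • h) v < 0 := by
  obtain ⟨ε₁, p₁, h₁⟩ := exists_pos_perturb A g h hA
  obtain ⟨ε₂, p₂, h₂⟩ := exists_pos_perturb N (-g) (-h) (by simpa using hN)
  -- Any smaller positive step also works, so the minimum of the two steps serves `A` and `N` at
  -- once.
  have key : ∀ a b ε ε' : ℝ, 0 < a → 0 < a + ε * b → 0 < ε' → ε' ≤ ε → 0 < a + ε' * b := by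
    intro a b ε ε' ha hab h0 hle
    rcases le_total 0 b with hb | hb
    · positivity
    · nlinarith
  refine ⟨min ε₁ ε₂, lt_min p₁ p₂, fun v hv => by simp [hK v hv, hh v hv], fun v hv => ?_,
    fun v hv => ?_⟩
  · simpa using key _ _ _ _ (hA v hv) (h₁ v hv) (lt_min p₁ p₂) (min_le_left _ _)
  · have := key _ _ _ _ (by simpa using hN v hv) (h₂ v hv) (lt_min p₁ p₂) (min_le_right _ _)
    simp only [LinearMap.neg_apply] at this
    simp only [LinearMap.add_apply, LinearMap.smul_apply, smul_eq_mul]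
    linarith

variable [DecidableEq V]

theorem rankSign_insert_of_mem {K : Finset V} {l : V}
    (hl : l ∈ Submodule.span ℝ (K : Set V)) : rankSign (insert l K) = rankSign K := by
  unfold rankSign
  rw [Finset.coe_insert, Submodule.span_insert_eq_span hl]

theorem rankSign_insert_of_notMem {K : Finset V} {l : V}
    (hl : l ∉ Submodule.span ℝ (K : Set V)) : rankSign (insert l K) = -rankSign K := by
  have hl0 : l ≠ 0 := fun h => hl (h ▸ Submodule.zero_mem _)
  unfold rankSign
  rw [Finset.coe_insert, Submodule.span_insert]
  have hd : Disjoint (Submodule.span ℝ {l}) (Submodule.span ℝ (K : Set V)) := by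
    rw [disjoint_comm]
    exact Submodule.disjoint_span_singleton_of_notMem hl
  have := Submodule.finrank_sup_add_finrank_inf_eq (Submodule.span ℝ {l})
    (Submodule.span ℝ (K : Set V))
  rw [hd.eq_bot, finrank_bot, finrank_span_singleton hl0] at this
  rw [add_zero] at this
  rw [this, add_comm, pow_succ]
  ring

open Classical in
/-- Cutting a cell of a hyperplane arrangement by one more hyperplane preserves the
Euler characteristic. -/
theorem signRealizable_cut (K A N : Finset V) (l : V) :
    (if SignRealizable K (insert l A) N then rankSign K else 0) +
      (if SignRealizable (insert l K) A N then rankSign (insert l K) else 0) +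
      (if SignRealizable K A (insert l N) then rankSign K else 0) =
    if SignRealizable K A N then rankSign K else 0 := by
  by_cases hf : SignRealizable K A N
  swap
  · rw [if_neg, if_neg, if_neg, if_neg hf]
    · simp
    · rintro ⟨g, h1, h2, h3⟩
      exact hf ⟨g, h1, h2, fun v hv => h3 v (Finset.mem_insert_of_mem hv)⟩
    · rintro ⟨g, h1, h2, h3⟩
      exact hf ⟨g, fun v hv => h1 v (Finset.mem_insert_of_mem hv), h2, h3⟩
    · rintro ⟨g, h1, h2, h3⟩
      exact hf ⟨g, h1, fun v hv => h2 v (Finset.mem_insert_of_mem hv), h3⟩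
  rw [if_pos hf]
  -- Here `l` vanishes on the whole cell, so only the middle piece survives, with unchanged rank.
  by_cases hl : l ∈ Submodule.span ℝ (K : Set V)
  · have h0 : ∀ g : Module.Dual ℝ V, (∀ v ∈ K, g v = 0) → g l = 0 :=
      fun g hg => eq_zero_of_mem_span (K := (K : Set V)) (by simpa using hg) hl
    rw [if_neg, if_pos, if_neg, rankSign_insert_of_mem hl]
    · simp
    · rintro ⟨g, h1, h2, h3⟩
      exact absurd (h3 l (Finset.mem_insert_self _ _)) (by simp [h0 g h1])
    · obtain ⟨g, h1, h2, h3⟩ := hf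
      refine ⟨g, fun v hv => ?_, h2, h3⟩
      rcases Finset.mem_insert.1 hv with rfl | hv
      · exact h0 g h1
      · exact h1 v hv
    · rintro ⟨g, h1, h2, h3⟩
      exact absurd (h2 l (Finset.mem_insert_self _ _)) (by simp [h0 g h1])
  obtain ⟨h, hhl, hhK⟩ := Submodule.exists_le_ker_of_notMem hl
  have hh : ∀ v ∈ K, h v = 0 := fun v hv => hhK (Submodule.subset_span hv)
  -- If the hyperplane of `l` meets the cell, all three pieces occur, with signs `s`, `-s`, `s`;
  -- otherwise the cell lies strictly on one side.
  by_cases hz : SignRealizable (insert l K) A N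
  · obtain ⟨g, h1, h2, h3⟩ := hz
    have hgl : g l = 0 := h1 l (Finset.mem_insert_self _ _)
    have h1' : ∀ v ∈ K, g v = 0 := fun v hv => h1 v (Finset.mem_insert_of_mem hv)
    have hpos : ∃ h : Module.Dual ℝ V, (∀ v ∈ K, h v = 0) ∧ 0 < h l := by
      rcases lt_or_gt_of_ne hhl with hlt | hgt
      · exact ⟨-h, by simpa using hh, by simpa using hlt⟩
      · exact ⟨h, hh, hgt⟩
    obtain ⟨p, hp, hpl⟩ := hpos
    rw [if_pos, if_pos ⟨g, h1, h2, h3⟩, if_pos, rankSign_insert_of_notMem hl]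
    · ring
    · obtain ⟨ε, hε, e1, e2, e3⟩ := SignRealizable.exists_perturb h1' h2 h3 (h := -p)
        (by simpa using hp)
      refine ⟨g + ε • -p, e1, e2, fun v hv => ?_⟩
      rcases Finset.mem_insert.1 hv with rfl | hv
      · simpa [hgl] using mul_pos hε hpl
      · exact e3 v hv
    · obtain ⟨ε, hε, e1, e2, e3⟩ := SignRealizable.exists_perturb h1' h2 h3 hp
      refine ⟨g + ε • p, e1, fun v hv => ?_, e3⟩
      rcases Finset.mem_insert.1 hv with rfl | hv
      · simpa [hgl] using mul_pos hε hpl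
      · exact e2 v hv
  · rw [if_neg hz]
    have hor : SignRealizable K (insert l A) N ∨ SignRealizable K A (insert l N) := by
      obtain ⟨g, h1, h2, h3⟩ := hf
      rcases lt_trichotomy (g l) 0 with hlt | heq | hgt
      · exact Or.inr ⟨g, h1, h2, by simpa [hlt] using h3⟩
      · exact absurd ⟨g, by simpa [heq] using h1, h2, h3⟩ hz
      · exact Or.inl ⟨g, h1, by simpa [hgt] using h2, h3⟩
    have hnot : ¬ (SignRealizable K (insert l A) N ∧ SignRealizable K A (insert l N)) := by
      rintro ⟨⟨f, f1, f2, f3⟩, ⟨g, g1, g2, g3⟩⟩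
      have hfl := f2 l (Finset.mem_insert_self _ _)
      have hgl := g3 l (Finset.mem_insert_self _ _)
      -- Points on opposite sides of the hyperplane have a positive combination on it.
      refine hz ⟨(-g l) • f + (f l) • g, fun v hv => ?_, fun v hv => ?_, fun v hv => ?_⟩
      · rcases Finset.mem_insert.1 hv with rfl | hv
        · simp only [LinearMap.add_apply, LinearMap.smul_apply, smul_eq_mul]; ring
        · simp [f1 v hv, g1 v hv]
      · have a := f2 v (Finset.mem_insert_of_mem hv)
        have b := g2 v hv
        simp only [LinearMap.add_apply, LinearMap.smul_apply, smul_eq_mul]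
        nlinarith [mul_pos (neg_pos.2 hgl) a, mul_pos hfl b]
      · have a := f3 v hv
        have b := g3 v (Finset.mem_insert_of_mem hv)
        simp only [LinearMap.add_apply, LinearMap.smul_apply, smul_eq_mul]
        nlinarith [mul_pos (neg_pos.2 hgl) (neg_pos.2 a), mul_pos hfl (neg_pos.2 b)]
    rcases hor with h | h
    · rw [if_pos h, if_neg fun h' => hnot ⟨h, h'⟩]; ring
    · rw [if_neg fun h' => hnot ⟨h', h⟩, if_pos h]; ring

open Classical in
/-- The Euler relation for the half-open cone of functionals that are nonnegative on `A` and
negative on `N`, in the space of functionals vanishing on `K`. -/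
theorem sum_powerset_rankSign_eq_zero {K A N : Finset V} (hA : A.Nonempty) {u : Module.Dual ℝ V}
    (huK : ∀ v ∈ K, u v = 0) (huA : ∀ v ∈ A, 0 < u v) (huN : ∀ v ∈ N, 0 < u v) :
    ∑ Z ∈ A.powerset, (if SignRealizable (K ∪ Z) (A \ Z) N then rankSign (K ∪ Z) else 0) = 0 := by
  -- `N` must vary: the step applies the hypothesis both to `N` and to `insert l N`.
  induction hA using Finset.Nonempty.cons_induction generalizing N with
  | singleton l =>
    have hul : 0 < u l := huA l (Finset.mem_singleton_self l)
    have hl : l ∉ Submodule.span ℝ (K : Set V) := fun h =>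
      hul.ne' (eq_zero_of_mem_span (K := (K : Set V)) (by simpa using huK) h)
    have hiff : SignRealizable K {l} N ↔ SignRealizable (insert l K) ∅ N := by
      constructor
      · rintro ⟨g, h1, h2, h3⟩
        have hgl := h2 l (Finset.mem_singleton_self l)
        -- This combination kills `l`, and subtracting a positive multiple of `u` keeps it negative
        -- on `N`.
        refine ⟨u l • g - g l • u, fun v hv => ?_, by simp, fun v hv => ?_⟩
        · rcases Finset.mem_insert.1 hv with rfl | hv
          · simp only [LinearMap.sub_apply, LinearMap.smul_apply, smul_eq_mul]; ring
          · simp [h1 v hv, huK v hv]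
        · simp only [LinearMap.sub_apply, LinearMap.smul_apply, smul_eq_mul]
          nlinarith [mul_pos hul (neg_pos.2 (h3 v hv)), mul_pos hgl (huN v hv)]
      · rintro ⟨g, h1, -, h3⟩
        obtain ⟨ε, hε, e1, -, e3⟩ := SignRealizable.exists_perturb (A := ∅)
          (fun v hv => h1 v (Finset.mem_insert_of_mem hv)) (by simp) h3 huK
        refine ⟨g + ε • u, e1, fun v hv => ?_, e3⟩
        rw [Finset.mem_singleton.1 hv]
        simpa [h1 l (Finset.mem_insert_self _ _)] using mul_pos hε hul
    rw [← insert_empty_eq, Finset.sum_powerset_insert (Finset.notMem_empty l)]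
    simp only [Finset.powerset_empty, Finset.sum_singleton, Finset.union_empty, Finset.sdiff_empty,
      insert_empty_eq, Finset.sdiff_self, Finset.union_singleton]
    rw [rankSign_insert_of_notMem hl]
    by_cases h : SignRealizable K {l} N
    · rw [if_pos h, if_pos (hiff.1 h)]; ring
    · rw [if_neg h, if_neg (hiff.not.1 h)]; ring
  | cons l A hl hA ih =>
    rw [Finset.cons_eq_insert] at huA ⊢
    have huA' : ∀ v ∈ A, 0 < u v := fun v hv => huA v (Finset.mem_insert_of_mem hv)
    have h1 := ih (N := N) huA' huN
    have h2 := ih (N := insert l N) huA' (by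
      simpa [huA l (Finset.mem_insert_self _ _)] using huN)
    rw [Finset.sum_powerset_insert hl, ← Finset.sum_add_distrib]
    -- Adding the vanishing sum for the part with `l` negative completes the half-open cone to the
    -- one without a condition on `l`; the cutting identity then applies term by term.
    refine (add_zero _).symm.trans ((congrArg (_ + ·) h2.symm).trans ?_)
    rw [← Finset.sum_add_distrib]
    refine Eq.trans (Finset.sum_congr rfl fun Z hZ => ?_) h1
    have hlZ : l ∉ Z := fun h => hl (Finset.mem_powerset.1 hZ h)
    rw [← signRealizable_cut (K ∪ Z) (A \ Z) N l, Finset.union_insert,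
      Finset.insert_sdiff_of_notMem _ hlZ, Finset.insert_sdiff_insert,
      Finset.sdiff_insert_of_notMem hl]

end SignPatterns

/-! ### Faces of a vector configuration and their Euler relation -/

section FaceSets

variable {V : Type*} [AddCommGroup V] [Module ℝ V]

/-- `Z` is the zero set on `S` of a linear functional that is nonnegative on `S`. -/
def IsFaceSet (S Z : Finset V) : Prop :=
  Z ⊆ S ∧ ∃ g : Module.Dual ℝ V, ∀ v ∈ S, 0 ≤ g v ∧ (g v = 0 ↔ v ∈ Z)

namespace IsFaceSet

variable {S T Y Z : Finset V}

theorem refl (S : Finset V) : IsFaceSet S S :=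
  ⟨subset_rfl, 0, fun v hv => by simp [hv]⟩

theorem of_subset (h : IsFaceSet S Z) (hZT : Z ⊆ T) (hTS : T ⊆ S) : IsFaceSet T Z :=
  ⟨hZT, h.2.imp fun _ hg v hv => hg v (hTS hv)⟩

/-- A small multiple of the functional for `Z`, added to the one for `T`, keeps it positive off `T`.
-/
theorem trans (hT : IsFaceSet S T) (hZ : IsFaceSet T Z) : IsFaceSet S Z := by
  classical
  obtain ⟨hTS, f, hf⟩ := hT
  obtain ⟨hZT, g, hg⟩ := hZ
  obtain ⟨ε, hε, hpos⟩ := exists_pos_perturb (S \ T) f g fun v hv => by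
    rw [Finset.mem_sdiff] at hv
    exact lt_of_le_of_ne (hf v hv.1).1 fun h => hv.2 ((hf v hv.1).2.1 h.symm)
  refine ⟨hZT.trans hTS, f + ε • g, fun v hv => ?_⟩
  simp only [LinearMap.add_apply, LinearMap.smul_apply, smul_eq_mul]
  by_cases hvT : v ∈ T
  · rw [(hf v hv).2.2 hvT, zero_add]
    refine ⟨mul_nonneg hε.le (hg v hvT).1, ?_⟩
    rw [mul_eq_zero, or_iff_right hε.ne', (hg v hvT).2]
  · have := hpos v (Finset.mem_sdiff.2 ⟨hv, hvT⟩)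
    exact ⟨this.le, fun h => absurd h this.ne', fun h => absurd (hZT h) hvT⟩

/-- The functional defining `Z` vanishes on its span but not at a vector of `T` outside `Z`. -/
theorem finrank_lt (h : IsFaceSet S Z) (hTS : T ⊆ S) (hZT : Z ⊂ T) :
    Module.finrank ℝ (Submodule.span ℝ (Z : Set V)) <
      Module.finrank ℝ (Submodule.span ℝ (T : Set V)) := by
  obtain ⟨-, g, hg⟩ := h
  obtain ⟨v, hvT, hvZ⟩ := Finset.exists_of_ssubset hZT
  refine Submodule.finrank_lt_finrank_of_lt (lt_of_le_of_ne
    (Submodule.span_mono (by exact_mod_cast hZT.1)) fun he => hvZ ?_)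
  have hv : v ∈ Submodule.span ℝ (Z : Set V) := he ▸ Submodule.subset_span hvT
  exact (hg v (hTS hvT)).2.1 (eq_zero_of_mem_span
    (fun w hw => (hg w (hTS (hZT.1 hw))).2.2 hw) hv)

/-- Rotate a supporting hyperplane: a rank gap of at least two leaves room for a functional `g` that
kills `Z` and some `v₀` outside it yet is negative somewhere on `T`. Tilting `f` towards `g` until
it first touches a new vector gives a larger face that still misses `v₀`. -/
theorem exists_between (h : IsFaceSet T Z)
    (hr : Module.finrank ℝ (Submodule.span ℝ (Z : Set V)) + 1 <
      Module.finrank ℝ (Submodule.span ℝ (T : Set V))) :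
    ∃ Y, IsFaceSet T Y ∧ Z ⊂ Y ∧ Y ⊂ T := by
  classical
  obtain ⟨hZT, f, hf⟩ := h
  have hfpos : ∀ v ∈ T \ Z, 0 < f v := fun v hv => by
    rw [Finset.mem_sdiff] at hv
    exact lt_of_le_of_ne (hf v hv.1).1 fun h => hv.2 ((hf v hv.1).2.1 h.symm)
  have hne : ∃ v₀ ∈ T, v₀ ∉ Z := by
    by_contra! hcon
    rw [hZT.antisymm hcon] at hr
    omega
  obtain ⟨v₀, hv₀T, hv₀Z⟩ := hne
  have hw : ∃ w ∈ T, w ∉ Submodule.span ℝ (insert v₀ (Z : Set V)) := by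
    by_contra! hcon
    have := FiniteDimensional.span_of_finite ℝ ((Finset.finite_toSet Z).insert v₀)
    have h1 := Submodule.finrank_mono (Submodule.span_le.2 hcon)
    rw [Submodule.span_insert] at h1
    have h2 := Submodule.finrank_add_le_finrank_add_finrank (Submodule.span ℝ {v₀})
      (Submodule.span ℝ (Z : Set V))
    have h3 := finrank_span_le_card (R := ℝ) ({v₀} : Set V)
    simp only [Set.toFinset_singleton, Finset.card_singleton] at h3
    omega
  obtain ⟨w, hwT, hw⟩ := hw
  obtain ⟨g, hgw, hg⟩ : ∃ g : Module.Dual ℝ V,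
      g w < 0 ∧ ∀ v ∈ insert v₀ (Z : Set V), g v = 0 := by
    obtain ⟨g, hgw, hg⟩ := Submodule.exists_le_ker_of_notMem hw
    have hg' : ∀ v ∈ insert v₀ (Z : Set V), g v = 0 := fun v hv => hg (Submodule.subset_span hv)
    rcases lt_or_gt_of_ne hgw with hlt | hgt
    · exact ⟨g, hlt, hg'⟩
    · exact ⟨-g, by simpa using hgt, fun v hv => by simp [hg' v hv]⟩
  have hwZ : w ∈ T \ Z := Finset.mem_sdiff.2
    ⟨hwT, fun h => hgw.ne (hg w (Set.mem_insert_of_mem _ h))⟩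
  obtain ⟨v₁, hv₁, hmax⟩ := Finset.exists_max_image (T \ Z) (fun v => -g v / f v) ⟨w, hwZ⟩
  -- The least `t` for which `t • f + g` is nonnegative on `T`; it vanishes at `v₁`.
  set t := -g v₁ / f v₁ with ht
  have htpos : 0 < t := lt_of_lt_of_le (div_pos (neg_pos.2 hgw) (hfpos w hwZ)) (hmax w hwZ)
  have hnonneg : ∀ v ∈ T, 0 ≤ (t • f + g) v := by
    intro v hv
    simp only [LinearMap.add_apply, LinearMap.smul_apply, smul_eq_mul]
    by_cases hvZ : v ∈ Z
    · rw [(hf v hv).2.2 hvZ, hg v (Set.mem_insert_of_mem _ hvZ)]; simp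
    · have hm := Finset.mem_sdiff.2 ⟨hv, hvZ⟩
      have := (div_le_iff₀ (hfpos v hm)).1 (hmax v hm)
      linarith
  refine ⟨T.filter fun v => (t • f + g) v = 0, ⟨Finset.filter_subset _ _, t • f + g,
    fun v hv => ⟨hnonneg v hv, by simp [hv]⟩⟩, ?_, ?_⟩
  · refine Finset.ssubset_iff_subset_ne.2 ⟨fun v hv => Finset.mem_filter.2 ⟨hZT hv, ?_⟩, fun he => ?_⟩
    · simp [(hf v (hZT hv)).2.2 hv, hg v (Set.mem_insert_of_mem _ hv)]
    · refine (Finset.mem_sdiff.1 hv₁).2 (he ▸ Finset.mem_filter.2 ⟨(Finset.mem_sdiff.1 hv₁).1, ?_⟩)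
      simp only [LinearMap.add_apply, LinearMap.smul_apply, smul_eq_mul, ht]
      rw [div_mul_cancel₀ _ (hfpos v₁ hv₁).ne']
      ring
  · refine Finset.ssubset_iff_subset_ne.2 ⟨Finset.filter_subset _ _, fun he => ?_⟩
    have h0 := (Finset.mem_filter.1 (he.symm ▸ hv₀T)).2
    simp only [LinearMap.add_apply, LinearMap.smul_apply, smul_eq_mul,
      hg v₀ (Set.mem_insert _ _), add_zero] at h0
    exact (mul_pos htpos (hfpos v₀ (Finset.mem_sdiff.2 ⟨hv₀T, hv₀Z⟩))).ne' h0

open Classical in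
/-- The Euler relation for the interval of face sets between `Z` and `T`. -/
theorem sum_rankSign_eq_zero (h : IsFaceSet T Z) (hne : Z ≠ T) :
    ∑ Y ∈ T.powerset with Z ⊆ Y ∧ IsFaceSet T Y, rankSign Y = 0 := by
  have hZT := h.1
  obtain ⟨-, f, hf⟩ := h
  have hA : (T \ Z).Nonempty := Finset.sdiff_nonempty.2 fun h' => hne (hZT.antisymm h')
  have key := sum_powerset_rankSign_eq_zero (K := Z) (A := T \ Z) (N := ∅) hA (u := f)
    (fun v hv => (hf v (hZT hv)).2.2 hv) (fun v hv => by
      rw [Finset.mem_sdiff] at hv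
      exact lt_of_le_of_ne (hf v hv.1).1 fun h => hv.2 ((hf v hv.1).2.1 h.symm)) (by simp)
  rw [← Finset.sum_filter] at key
  -- With no negative vectors, realizable sign patterns are exactly face sets; the sum is then
  -- reindexed by `Y ↦ Y \ Z`.
  have hiff : ∀ X, Z ⊆ X → X ⊆ T →
      (SignRealizable X (T \ X) ∅ ↔ IsFaceSet T X) := by
    intro X hZX hX
    constructor
    · rintro ⟨g, h1, h2, -⟩
      refine ⟨hX, g, fun v hv => ?_⟩
      by_cases hvX : v ∈ X
      · simp [h1 v hvX, hvX]
      · have := h2 v (Finset.mem_sdiff.2 ⟨hv, hvX⟩)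
        exact ⟨this.le, fun h => absurd h this.ne', fun h => absurd h hvX⟩
    · rintro ⟨-, g, hg⟩
      refine ⟨g, fun v hv => (hg v (hX hv)).2.2 hv, fun v hv => ?_, by simp⟩
      rw [Finset.mem_sdiff] at hv
      exact lt_of_le_of_ne (hg v hv.1).1 fun h => hv.2 ((hg v hv.1).2.1 h.symm)
  rw [← key]
  refine Finset.sum_bij' (fun Y _ => Y \ Z) (fun X _ => Z ∪ X) ?_ ?_ ?_ ?_ ?_
  · intro Y hY
    simp only [Finset.mem_filter, Finset.mem_powerset] at hY ⊢
    obtain ⟨hYT, hZY, hY⟩ := hY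
    refine ⟨Finset.sdiff_subset_sdiff hYT subset_rfl, ?_⟩
    rw [sdiff_sdiff_left, Finset.sup_eq_union, Finset.union_sdiff_of_subset hZY]
    exact (hiff Y hZY hYT).2 hY
  · intro X hX
    simp only [Finset.mem_filter, Finset.mem_powerset] at hX ⊢
    obtain ⟨hXT, hX⟩ := hX
    have hsub : Z ∪ X ⊆ T := Finset.union_subset hZT (hXT.trans Finset.sdiff_subset)
    refine ⟨hsub, Finset.subset_union_left, (hiff _ Finset.subset_union_left hsub).1 ?_⟩
    rwa [sdiff_sdiff_left] at hX
  · intro Y hY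
    simp only [Finset.mem_filter, Finset.mem_powerset] at hY
    exact Finset.union_sdiff_of_subset hY.2.1
  · intro X hX
    simp only [Finset.mem_filter, Finset.mem_powerset] at hX
    rw [Finset.union_sdiff_left]
    exact Finset.sdiff_eq_self_of_disjoint (Finset.subset_sdiff.1 hX.1).2
  · intro Y hY
    simp only [Finset.mem_filter, Finset.mem_powerset] at hY
    rw [Finset.union_sdiff_of_subset hY.2.1]

end IsFaceSet

end FaceSets

/-! ### Eulerian rank functions -/

section EulerianRank

/-- `r` is the rank function of a finite Eulerian poset of rank `n` with least and greatest
elements. -/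
structure IsEulerianRank {L : Type*} [PartialOrder L] [Fintype L] (n : ℕ) (r : L → ℕ) : Prop where
  strictMono : StrictMono r
  rank_covBy : ∀ ⦃x y⦄, x ⋖ y → r y = r x + 1
  exists_isBot : ∃ x, IsBot x ∧ r x = 0
  exists_isTop : ∃ x, IsTop x ∧ r x = n
  sum_eq_zero : ∀ ⦃x y : L⦄, x < y → ∀ [DecidablePred fun z => x ≤ z ∧ z ≤ y],
    ∑ z with x ≤ z ∧ z ≤ y, (-1 : ℤ) ^ r z = 0

namespace IsEulerianRank

variable {L M : Type*} [PartialOrder L] [Fintype L] [PartialOrder M] [Fintype M] {n : ℕ}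

theorem comp_orderIso {r : M → ℕ} (h : IsEulerianRank n r) (e : L ≃o M) :
    IsEulerianRank n (r ∘ e) where
  strictMono := h.strictMono.comp e.strictMono
  rank_covBy x y hxy := h.rank_covBy ((apply_covBy_apply_iff e).2 hxy)
  exists_isBot := by
    obtain ⟨x, hx, hr⟩ := h.exists_isBot
    exact ⟨e.symm x, fun y => e.symm_apply_le.2 (hx _), by simpa using hr⟩
  exists_isTop := by
    obtain ⟨x, hx, hr⟩ := h.exists_isTop
    exact ⟨e.symm x, fun y => e.le_symm_apply.2 (hx _), by simpa using hr⟩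
  sum_eq_zero x y hxy _ := by
    classical
    rw [← h.sum_eq_zero (e.lt_iff_lt.2 hxy), Finset.sum_filter, Finset.sum_filter,
      ← e.toEquiv.sum_comp]
    simp

variable {r : L → ℕ} (h : IsEulerianRank n r)
include h

theorem rank_le (x : L) : r x ≤ n := by
  obtain ⟨t, ht, rfl⟩ := h.exists_isTop
  exact h.strictMono.monotone (ht x)

theorem exists_rank_eq {k : ℕ} (hk : k ≤ n) : ∃ x, r x = k := by
  induction k with
  | zero => exact h.exists_isBot.imp fun _ => And.right
  | succ k ih =>
    obtain ⟨x, rfl⟩ := ih (by omega)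
    obtain ⟨t, ht, rfl⟩ := h.exists_isTop
    have hlt : x < t := lt_of_le_of_ne (ht x) (by rintro rfl; omega)
    obtain ⟨y, hy, -⟩ := exists_covBy_le_of_lt hlt
    exact ⟨y, h.rank_covBy hy⟩

theorem exists_covBy_rank_eq {k : ℕ} (hk : k + 1 ≤ n) :
    ∃ x y, x ⋖ y ∧ r x = k ∧ r y = k + 1 := by
  obtain ⟨x, rfl⟩ := h.exists_rank_eq (k := k) (by omega)
  obtain ⟨t, ht, rfl⟩ := h.exists_isTop
  have hlt : x < t := lt_of_le_of_ne (ht x) (by rintro rfl; omega)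
  obtain ⟨y, hy, -⟩ := exists_covBy_le_of_lt hlt
  exact ⟨x, y, hy, rfl, h.rank_covBy hy⟩

/-- Half-open sums are needed because a new element takes the place of an endpoint of an old
interval. -/
theorem sum_Ico {x y : L} (hxy : x < y) [DecidablePred fun z => x ≤ z ∧ z < y] :
    ∑ z with x ≤ z ∧ z < y, (-1 : ℤ) ^ r z = -(-1) ^ r y := by
  classical
  have h0 := h.sum_eq_zero hxy
  have : (Finset.univ.filter fun z => x ≤ z ∧ z ≤ y) =
      insert y (Finset.univ.filter fun z => x ≤ z ∧ z < y) := by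
    ext z
    simp only [Finset.mem_filter, Finset.mem_univ, true_and, Finset.mem_insert, le_iff_eq_or_lt (b := y)]
    constructor
    · tauto
    · rintro (rfl | h)
      · exact ⟨hxy.le, Or.inl rfl⟩
      · tauto
  rw [this, Finset.sum_insert (by simp)] at h0
  linarith

theorem sum_Ioc {x y : L} (hxy : x < y) [DecidablePred fun z => x < z ∧ z ≤ y] :
    ∑ z with x < z ∧ z ≤ y, (-1 : ℤ) ^ r z = -(-1) ^ r x := by
  classical
  have h0 := h.sum_eq_zero hxy
  have : (Finset.univ.filter fun z => x ≤ z ∧ z ≤ y) =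
      insert x (Finset.univ.filter fun z => x < z ∧ z ≤ y) := by
    ext z
    simp only [Finset.mem_filter, Finset.mem_univ, true_and, Finset.mem_insert, le_iff_eq_or_lt (a := x)]
    constructor
    · rintro ⟨rfl | h, h'⟩
      · exact Or.inl rfl
      · exact Or.inr ⟨h, h'⟩
    · rintro (rfl | h)
      · exact ⟨Or.inl rfl, hxy.le⟩
      · tauto
  rw [this, Finset.sum_insert (by simp)] at h0
  linarith

end IsEulerianRank

/-- Translates between the parity count defining Eulerian posets and alternating sums. -/
theorem card_even_eq_card_odd_iff {α : Type*} (p : α → Prop) (r : α → ℕ) [Fintype α]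
    [DecidablePred p] :
    {z | p z ∧ Even (r z)}.ncard = {z | p z ∧ Odd (r z)}.ncard ↔
      ∑ z with p z, (-1 : ℤ) ^ r z = 0 := by
  classical
  have h : ∑ z with p z, (-1 : ℤ) ^ r z =
      ({z | p z ∧ Even (r z)}.ncard : ℤ) - {z | p z ∧ Odd (r z)}.ncard := by
    rw [Set.ncard_eq_toFinset_card', Set.ncard_eq_toFinset_card',
      ← Finset.sum_filter_add_sum_filter_not _ (fun z => Even (r z)),
      Finset.sum_congr rfl (fun z hz => (Finset.mem_filter.1 hz).2.neg_one_pow),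
      Finset.sum_congr rfl (g := fun _ => (-1 : ℤ)) (fun z hz =>
        (Nat.not_even_iff_odd.1 (Finset.mem_filter.1 hz).2).neg_one_pow)]
    simp [Finset.filter_filter, sub_eq_add_neg]
  rw [h, sub_eq_zero, Nat.cast_inj]

end EulerianRank

/-! ### The poset of face sets is Eulerian -/

section FaceSetRank

variable {V : Type*} [AddCommGroup V] [Module ℝ V]

noncomputable instance (S : Finset V) : Fintype {Z : Finset V // IsFaceSet S Z} :=
  @Fintype.ofFinite _ (Set.Finite.subset (Finset.finite_toSet S.powerset)
    (fun _ hZ => Finset.mem_coe.2 (Finset.mem_powerset.2 hZ.1))).to_subtype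

/-- The poset of face sets of a pointed configuration of vectors is Eulerian. -/
theorem isEulerianRank_faceSet (S : Finset V) (h0 : IsFaceSet S ∅) :
    IsEulerianRank (Module.finrank ℝ (Submodule.span ℝ (S : Set V)))
      fun Z : {Z : Finset V // IsFaceSet S Z} =>
        Module.finrank ℝ (Submodule.span ℝ (Z.1 : Set V)) where
  strictMono Y Z hYZ := Y.2.finrank_lt Z.2.1 hYZ
  rank_covBy Y Z hYZ := by
    have hlt := Y.2.finrank_lt Z.2.1 hYZ.lt
    by_contra hne
    obtain ⟨W, hW, hYW, hWZ⟩ := (Y.2.of_subset hYZ.le Z.2.1).exists_between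
      (by omega)
    exact hYZ.2 (c := ⟨W, Z.2.trans hW⟩) hYW hWZ
  exists_isBot := ⟨⟨∅, h0⟩, fun Z => Finset.empty_subset Z.1, by simp⟩
  exists_isTop := ⟨⟨S, IsFaceSet.refl S⟩, fun Z => Z.2.1, rfl⟩
  sum_eq_zero Z T hZT _ := by
    classical
    rw [← (Z.2.of_subset hZT.le T.2.1).sum_rankSign_eq_zero fun h => hZT.ne (Subtype.ext h)]
    refine Finset.sum_bij (fun Y _ => Y.1) ?_ (fun _ _ _ _ h => Subtype.ext h) ?_ fun _ _ => rfl
    · intro Y hY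
      simp only [Finset.mem_filter, Finset.mem_univ, true_and, Finset.mem_powerset] at hY ⊢
      exact ⟨hY.2, hY.1, Y.2.of_subset hY.2 T.2.1⟩
    · intro Y hY
      simp only [Finset.mem_filter, Finset.mem_univ, true_and, Finset.mem_powerset] at hY ⊢
      exact ⟨⟨Y, T.2.trans hY.2.2⟩, ⟨hY.2.1, hY.1⟩, rfl⟩

end FaceSetRank

/-! ### From polytopes to vector configurations at height one -/

section Homogenization

variable {E : Type*}

/-- The embedding of `E` as the hyperplane at height one in `E × ℝ`. -/
def homogenize : E ↪ E × ℝ := ⟨fun x => (x, 1), fun _ _ h => (Prod.ext_iff.1 h).1⟩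

@[simp] theorem homogenize_apply (x : E) : homogenize x = (x, (1 : ℝ)) := rfl

variable [NormedAddCommGroup E] [NormedSpace ℝ E]

theorem dual_prod_apply (g : Module.Dual ℝ (E × ℝ)) (x : E) :
    g (x, 1) = g (x, 0) + g (0, 1) := by
  rw [← map_add]; simp

/-- A functional is affine on the hyperplane at height one. -/
theorem dual_prod_sum {ι : Type*} (g : Module.Dual ℝ (E × ℝ)) (t : Finset ι) (w : ι → ℝ)
    (z : ι → E) (hw : ∑ i ∈ t, w i = 1) :
    g (∑ i ∈ t, w i • z i, 1) = ∑ i ∈ t, w i * g (z i, 1) := by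
  have : ((∑ i ∈ t, w i • z i, 1) : E × ℝ) = ∑ i ∈ t, w i • (z i, (1 : ℝ)) := by
    ext
    · simp [Prod.fst_sum]
    · simp [Prod.snd_sum, hw]
  rw [this, map_sum]
  exact Finset.sum_congr rfl fun i _ => by rw [map_smul, smul_eq_mul]

theorem dual_prod_nonneg {S : Finset E} {g : Module.Dual ℝ (E × ℝ)}
    (hg : ∀ x ∈ S, 0 ≤ g (x, 1)) {x : E} (hx : x ∈ convexHull ℝ (S : Set E)) : 0 ≤ g (x, 1) := by
  have hc : Convex ℝ {x : E | 0 ≤ g (x, 1)} := by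
    intro x hx y hy a b ha hb hab
    have h1 : ((a • x + b • y, 1) : E × ℝ) = a • (x, (1 : ℝ)) + b • (y, (1 : ℝ)) := by
      ext <;> simp [hab]
    simp only [Set.mem_ofPred_eq] at hx hy ⊢
    rw [h1, map_add, map_smul, map_smul, smul_eq_mul, smul_eq_mul]
    positivity
  exact convexHull_min (s := (S : Set E)) (fun x hx => hg x hx) hc hx

/-- A face of a polytope is the convex hull of the spanning points it contains. -/
theorem setOf_mem_convexHull_eq_zero {S : Finset E} {g : Module.Dual ℝ (E × ℝ)}
    (hg : ∀ x ∈ S, 0 ≤ g (x, 1)) :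
    {x ∈ convexHull ℝ (S : Set E) | g (x, 1) = 0} = convexHull ℝ {x ∈ (S : Set E) | g (x, 1) = 0} := by
  apply Set.Subset.antisymm
  · rintro x ⟨hx, hgx⟩
    rw [Finset.convexHull_eq] at hx
    obtain ⟨w, hw0, hw1, rfl⟩ := hx
    rw [Finset.centerMass_eq_of_sum_1 _ _ hw1] at hgx ⊢
    rw [dual_prod_sum g S w id hw1] at hgx
    simp only [id] at hgx
    rw [Finset.sum_eq_zero_iff_of_nonneg fun i hi => mul_nonneg (hw0 i hi) (hg i hi)] at hgx
    rw [← Finset.centerMass_eq_of_sum_1 _ _ hw1]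
    classical
    rw [← Finset.centerMass_filter_ne_zero]
    refine Finset.centerMass_mem_convexHull _ (fun i hi => hw0 i (Finset.mem_filter.1 hi).1) ?_ ?_
    · rw [Finset.sum_filter_ne_zero, hw1]; exact one_pos
    · intro i hi
      rw [Finset.mem_filter] at hi
      exact ⟨hi.1, (mul_eq_zero.1 (hgx i hi.1)).resolve_left hi.2⟩
  · refine convexHull_min (fun x hx => ⟨subset_convexHull ℝ _ hx.1, hx.2⟩) ?_
    refine (convex_convexHull ℝ _).inter (t := {x : E | g (x, 1) = 0}) ?_
    intro x hx y hy a b ha hb hab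
    have h1 : ((a • x + b • y, 1) : E × ℝ) = a • (x, (1 : ℝ)) + b • (y, (1 : ℝ)) := by
      ext <;> simp [hab]
    simp only [Set.mem_ofPred_eq] at hx hy ⊢
    rw [h1, map_add, map_smul, map_smul, hx, hy]
    simp

variable [FiniteDimensional ℝ E]

/-- Affine functions on `E` are linear functionals on `E × ℝ` restricted to height one, so
maximizing `l` amounts to the vanishing of the nonnegative affine function `max l - l`. -/
theorem isExposed_convexHull_iff (S : Finset E) (F : Set E) :
    IsExposed ℝ (convexHull ℝ (S : Set E)) F ↔
      ∃ g : Module.Dual ℝ (E × ℝ), (∀ x ∈ S, 0 ≤ g (x, 1)) ∧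
        F = {x ∈ convexHull ℝ (S : Set E) | g (x, 1) = 0} := by
  constructor
  · intro h
    rcases F.eq_empty_or_nonempty with rfl | hne
    -- The height functional equals one on the polytope, so it cuts out the empty face.
    · exact ⟨LinearMap.snd ℝ E ℝ, by simp, by simp⟩
    obtain ⟨l, hl⟩ := h hne
    obtain ⟨x₀, hx₀⟩ := hne
    rw [hl] at hx₀
    refine ⟨l x₀ • LinearMap.snd ℝ E ℝ - (l : E →ₗ[ℝ] ℝ) ∘ₗ LinearMap.fst ℝ E ℝ,
      fun x hx => ?_, ?_⟩
    · simpa using hx₀.2 x (subset_convexHull ℝ _ hx)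
    · rw [hl]
      ext x
      simp only [Set.mem_ofPred_eq, LinearMap.sub_apply, LinearMap.smul_apply, LinearMap.snd_apply,
        LinearMap.comp_apply, LinearMap.fst_apply, smul_eq_mul, mul_one, sub_eq_zero]
      refine and_congr_right fun hx => ⟨fun h => le_antisymm (h _ hx₀.1) (hx₀.2 _ hx), fun h y hy => ?_⟩
      exact (hx₀.2 y hy).trans_eq h
  · rintro ⟨g, hg, rfl⟩ ⟨x₀, hx₀, hgx₀⟩
    refine ⟨LinearMap.toContinuousLinearMap (-(g ∘ₗ LinearMap.inl ℝ E ℝ)), ?_⟩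
    ext x
    simp only [Set.mem_ofPred_eq, LinearMap.coe_toContinuousLinearMap', LinearMap.neg_apply,
      LinearMap.comp_apply, LinearMap.inl_apply, neg_le_neg_iff]
    refine and_congr_right fun hx => ⟨fun h y hy => ?_, fun h => ?_⟩
    · have := dual_prod_nonneg hg hy
      rw [dual_prod_apply] at this h
      linarith
    · have h1 := h x₀ hx₀
      have h2 := dual_prod_nonneg hg hx
      rw [dual_prod_apply] at hgx₀ h2 ⊢
      linarith

open Classical in
/-- The face lattice of a polytope is isomorphic to the poset of face sets of its homogenization. -/
noncomputable def faceLatticeEquiv (S : Finset E) :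
    FaceLattice (convexHull ℝ (S : Set E)) ≃o
      {Z : Finset (E × ℝ) // IsFaceSet (S.map homogenize) Z} :=
  have left_inv : ∀ F : FaceLattice (convexHull ℝ (S : Set E)),
      convexHull ℝ {x : E | homogenize x ∈ (S.map homogenize).filter fun v => v.1 ∈ F.1} = F.1 := by
    rintro ⟨F, hF⟩
    obtain ⟨g, hg, hFg⟩ := (isExposed_convexHull_iff S F).1 hF
    refine Eq.trans ?_ ((setOf_mem_convexHull_eq_zero hg).symm.trans hFg.symm)
    refine congrArg (convexHull ℝ) (Set.ext fun x => ?_)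
    simp only [Finset.mem_filter, Finset.mem_map', Set.mem_ofPred_eq,
      SetLike.mem_coe]
    refine and_congr_right fun hx => ?_
    rw [hFg]
    exact and_iff_right (subset_convexHull ℝ _ hx)
  { toFun := fun F => ⟨(S.map homogenize).filter fun v => v.1 ∈ F.1, Finset.filter_subset _ _, by
      obtain ⟨F, hF⟩ := F
      obtain ⟨g, hg, hFg⟩ := (isExposed_convexHull_iff S F).1 hF
      refine ⟨g, fun v hv => ?_⟩
      obtain ⟨x, hx, rfl⟩ := Finset.mem_map.1 hv
      refine ⟨hg x hx, ?_⟩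
      rw [Finset.mem_filter, and_iff_right hv]
      change _ ↔ x ∈ F
      rw [hFg]
      exact (and_iff_right (subset_convexHull ℝ _ hx)).symm⟩
    invFun := fun Z => ⟨convexHull ℝ {x : E | homogenize x ∈ Z.1}, by
      obtain ⟨Z, hZ, g, hg⟩ := Z
      have hg' : ∀ x ∈ S, 0 ≤ g (x, 1) ∧ (g (x, 1) = 0 ↔ homogenize x ∈ Z) :=
        fun x hx => hg _ (Finset.mem_map_of_mem homogenize hx)
      refine (isExposed_convexHull_iff S _).2 ⟨g, fun x hx => (hg' x hx).1, ?_⟩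
      rw [setOf_mem_convexHull_eq_zero fun x hx => (hg' x hx).1]
      congr 1
      ext x
      refine ⟨fun h => ?_, fun h => (hg' x h.1).2.1 h.2⟩
      have hx : x ∈ S := (Finset.mem_map' homogenize).1 (hZ h)
      exact ⟨hx, (hg' x hx).2.2 h⟩⟩
    left_inv := fun F => Subtype.ext (left_inv F)
    right_inv := by
      rintro ⟨Z, hZ, g, hg⟩
      refine Subtype.ext (Finset.ext fun v => ?_)
      dsimp only
      rw [Finset.mem_filter]
      constructor
      · rintro ⟨hv, hvZ⟩
        refine (hg v hv).2.1 ?_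
        obtain ⟨x, hx, rfl⟩ := Finset.mem_map.1 hv
        refine (convexHull_min (t := {x ∈ convexHull ℝ (S : Set E) | g (x, 1) = 0})
          (fun y hy => ?_) ?_ hvZ).2
        · exact ⟨subset_convexHull ℝ _ ((Finset.mem_map' homogenize).1 (hZ hy)),
            (hg _ (hZ hy)).2.2 hy⟩
        · rw [setOf_mem_convexHull_eq_zero fun x hx => (hg _ (Finset.mem_map_of_mem homogenize hx)).1]
          exact convex_convexHull ℝ _
      · intro hv
        refine ⟨hZ hv, ?_⟩
        obtain ⟨x, hx, rfl⟩ := Finset.mem_map.1 (hZ hv)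
        exact subset_convexHull ℝ _ hv
    map_rel_iff' := by
      intro F F'
      refine ⟨fun h => ?_, fun h v hv => ?_⟩
      · change F.1 ⊆ F'.1
        rw [← left_inv F, ← left_inv F']
        exact convexHull_mono fun x hx => h hx
      · exact Finset.mem_filter.2 ⟨(Finset.mem_filter.1 hv).1, h (Finset.mem_filter.1 hv).2⟩ }

theorem faceLatticeEquiv_symm_coe (S : Finset E) (Z) :
    ((faceLatticeEquiv S).symm Z).1 = convexHull ℝ {x : E | homogenize x ∈ Z.1} := rfl

/-- The span is the line through one point at height one plus the direction space at height zero.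
The empty set fits because its dimension is `-1`. -/
theorem finrank_span_homogenize (X : Set E) :
    (Module.finrank ℝ (Submodule.span ℝ (homogenize '' X)) : ℤ) = affDim (convexHull ℝ X) + 1 := by
  unfold affDim
  rcases X.eq_empty_or_nonempty with rfl | ⟨x₀, hx₀⟩
  · simp
  rw [if_pos ⟨x₀, subset_convexHull ℝ _ hx₀⟩, ← direction_affineSpan, affineSpan_convexHull,
    direction_affineSpan]
  have hspan : Submodule.span ℝ (homogenize '' X) =
      Submodule.span ℝ {(x₀, (1 : ℝ))} ⊔ (vectorSpan ℝ X).map (LinearMap.inl ℝ E ℝ) := by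
    apply le_antisymm
    · rw [Submodule.span_le]
      rintro _ ⟨x, hx, rfl⟩
      refine Submodule.mem_sup.2 ⟨_, Submodule.mem_span_singleton_self _, _,
        Submodule.mem_map_of_mem (vsub_mem_vectorSpan ℝ hx hx₀), ?_⟩
      simp
    · refine sup_le (Submodule.span_mono (Set.singleton_subset_iff.2 ⟨x₀, hx₀, rfl⟩)) ?_
      rw [Submodule.map_le_iff_le_comap, vectorSpan_eq_span_vsub_set_right ℝ hx₀, Submodule.span_le]
      rintro _ ⟨x, hx, rfl⟩
      have : LinearMap.inl ℝ E ℝ (x -ᵥ x₀) = homogenize x - homogenize x₀ := by simp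
      change LinearMap.inl ℝ E ℝ (x -ᵥ x₀) ∈ Submodule.span ℝ (homogenize '' X)
      rw [this]
      exact Submodule.sub_mem _ (Submodule.subset_span ⟨x, hx, rfl⟩)
        (Submodule.subset_span ⟨x₀, hx₀, rfl⟩)
  have hd : Disjoint ((vectorSpan ℝ X).map (LinearMap.inl ℝ E ℝ))
      (Submodule.span ℝ {(x₀, (1 : ℝ))}) := by
    refine Submodule.disjoint_span_singleton_of_notMem ?_
    rintro ⟨y, -, hy⟩
    simpa using congrArg Prod.snd hy
  have := Submodule.finrank_sup_add_finrank_inf_eq (Submodule.span ℝ {(x₀, (1 : ℝ))})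
    ((vectorSpan ℝ X).map (LinearMap.inl ℝ E ℝ))
  rw [hd.symm.eq_bot, finrank_bot, finrank_span_singleton (by simp),
    ← (Submodule.equivMapOfInjective (LinearMap.inl ℝ E ℝ) LinearMap.inl_injective
      (vectorSpan ℝ X)).finrank_eq] at this
  rw [hspan]
  omega

theorem finrank_span_faceLatticeEquiv (S : Finset E) (F : FaceLattice (convexHull ℝ (S : Set E))) :
    (Module.finrank ℝ (Submodule.span ℝ (((faceLatticeEquiv S F).1 : Finset (E × ℝ)) :
      Set (E × ℝ))) : ℤ) = affDim F.1 + 1 := by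
  have h := faceLatticeEquiv_symm_coe S (faceLatticeEquiv S F)
  rw [OrderIso.symm_apply_apply] at h
  rw [h, ← finrank_span_homogenize]
  have himage : (((faceLatticeEquiv S F).1 : Finset (E × ℝ)) : Set (E × ℝ)) =
      homogenize '' {x : E | homogenize x ∈ (faceLatticeEquiv S F).1} := by
    ext v
    constructor
    · intro hv
      obtain ⟨x, hx, rfl⟩ := Finset.mem_map.1 ((faceLatticeEquiv S F).2.1 hv)
      exact ⟨x, hv, rfl⟩
    · rintro ⟨x, hx, rfl⟩
      exact hx
  rw [← himage]

/-- The face lattice of a `d`-polytope is an Eulerian poset of rank `d + 1`, with the rank given by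
the dimension. -/
theorem IsPolytopeOfDim.exists_isEulerianRank {d : ℕ} {P : Set E} (hP : IsPolytopeOfDim d P) :
    ∃ (_ : Fintype (FaceLattice P)) (r : FaceLattice P → ℕ), IsEulerianRank (d + 1) r ∧
      ∀ F, (r F : ℤ) = affDim F.1 + 1 := by
  obtain ⟨⟨s, hs, rfl⟩, hd⟩ := hP
  lift s to Finset E using hs
  -- The configuration is pointed: height is positive on every vector.
  have h0 : IsFaceSet (s.map homogenize) ∅ := by
    refine ⟨Finset.empty_subset _, LinearMap.snd ℝ E ℝ, fun v hv => ?_⟩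
    obtain ⟨x, -, rfl⟩ := Finset.mem_map.1 hv
    simp
  have hn : Module.finrank ℝ (Submodule.span ℝ ((s.map homogenize : Finset (E × ℝ)) :
      Set (E × ℝ))) = d + 1 := by
    have := finrank_span_homogenize (s : Set E)
    rw [hd] at this
    rw [Finset.coe_map]
    exact_mod_cast this
  have h := isEulerianRank_faceSet (s.map homogenize) h0
  rw [hn] at h
  let : Fintype (FaceLattice (convexHull ℝ (s : Set E))) :=
    Fintype.ofEquiv _ (faceLatticeEquiv s).toEquiv.symm
  exact ⟨inferInstance, _, h.comp_orderIso (faceLatticeEquiv s),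
    finrank_span_faceLatticeEquiv s⟩

end Homogenization

/-! ### Adjoining the block of four elements -/

section FourExtension

/-- The poset `L` with four further elements adjoined: `A 0`, `A 1` with the strict lower bounds
of `F`, and `B 0`, `B 1` above them with the strict upper bounds of `G`. -/
inductive FourExtension {L : Type*} (F G : L)
  | old : L → FourExtension F G
  | A : Fin 2 → FourExtension F G
  | B : Fin 2 → FourExtension F G

namespace FourExtension

variable {L : Type*} {F G : L}

/-- The underlying type of a four-element extension, as a sum. -/
def equivSum (F G : L) : FourExtension F G ≃ L ⊕ (Fin 2 ⊕ Fin 2) where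
  toFun
    | old x => Sum.inl x
    | A i => Sum.inr (Sum.inl i)
    | B i => Sum.inr (Sum.inr i)
  invFun := Sum.elim old (Sum.elim A B)
  left_inv q := by cases q <;> rfl
  right_inv q := by rcases q with x | i | i <;> rfl

instance [Fintype L] : Fintype (FourExtension F G) := Fintype.ofEquiv _ (equivSum F G).symm

theorem sum_eq [Fintype L] (f : FourExtension F G → ℤ) :
    ∑ q, f q = ∑ x, f (old x) + (∑ i, f (A i) + ∑ i, f (B i)) := by
  rw [← (equivSum F G).symm.sum_comp, Fintype.sum_sum_type, Fintype.sum_sum_type]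
  rfl

/-- The rank function of the extension, given one on `L`. -/
def rank (r : L → ℕ) : FourExtension F G → ℕ
  | old x => r x
  | A _ => r F
  | B _ => r G

variable [PartialOrder L]

/-- The order relation of the extension. -/
protected def le : FourExtension F G → FourExtension F G → Prop
  | old x, old y => x ≤ y
  | old x, A _ => x < F
  | old x, B _ => x < F
  | A _, old y => G < y
  | A i, A k => i = k
  | A _, B _ => True
  | B _, old y => G < y
  | B _, A _ => False
  | B i, B k => i = k

instance : LE (FourExtension F G) := ⟨FourExtension.le⟩

@[simp] theorem old_le_old {x y : L} : (old x : FourExtension F G) ≤ old y ↔ x ≤ y := Iff.rfl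
@[simp] theorem old_le_A {x : L} {i : Fin 2} : (old x : FourExtension F G) ≤ A i ↔ x < F := Iff.rfl
@[simp] theorem old_le_B {x : L} {i : Fin 2} : (old x : FourExtension F G) ≤ B i ↔ x < F := Iff.rfl
@[simp] theorem A_le_old {y : L} {i : Fin 2} : (A i : FourExtension F G) ≤ old y ↔ G < y := Iff.rfl
@[simp] theorem A_le_A {i k : Fin 2} : (A i : FourExtension F G) ≤ A k ↔ i = k := Iff.rfl
@[simp] theorem A_le_B {i k : Fin 2} : (A i : FourExtension F G) ≤ B k ↔ True := Iff.rfl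
@[simp] theorem B_le_old {y : L} {i : Fin 2} : (B i : FourExtension F G) ≤ old y ↔ G < y := Iff.rfl
@[simp] theorem B_le_A {i k : Fin 2} : (B i : FourExtension F G) ≤ A k ↔ False := Iff.rfl
@[simp] theorem B_le_B {i k : Fin 2} : (B i : FourExtension F G) ≤ B k ↔ i = k := Iff.rfl

theorem rank_le [Fintype L] {n : ℕ} {r : L → ℕ} (h : IsEulerianRank n r)
    (q : FourExtension F G) : rank r q ≤ n := by
  cases q <;> exact h.rank_le _

variable [hFG : Fact (F ≤ G)]

/-- Transitivity through a new element needs `F ≤ G`, so that `x < F` and `G < y` give `x < y`; the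
same inequality excludes `G < x < F`. -/
instance : PartialOrder (FourExtension F G) where
  le_refl q := by cases q <;> simp
  le_trans p q s hpq hqs := by
    have hFG := hFG.out
    rcases p with x | i | i <;> rcases q with y | k | k <;> rcases s with z | l | l <;>
      simp only [old_le_old, old_le_A, old_le_B, A_le_old, A_le_A, A_le_B, B_le_old, B_le_A, B_le_B]
        at hpq hqs ⊢ <;>
      first
        | exact hpq.trans hqs
        | exact hpq.trans_lt hqs
        | exact hpq.trans_le hqs
        | exact (hpq.trans (hFG.trans_lt hqs)).le
        | exact ((hpq.trans hqs).not_ge hFG).elim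
        | simp_all
  le_antisymm p q hpq hqp := by
    have hFG := hFG.out
    rcases p with x | i | i <;> rcases q with y | k | k <;>
      simp only [old_le_old, old_le_A, old_le_B, A_le_old, A_le_A, A_le_B, B_le_old, B_le_A, B_le_B]
        at hpq hqp <;>
      first
        | exact congrArg _ (le_antisymm hpq hqp)
        | exact congrArg _ hpq
        | exact ((hpq.trans hqp).not_ge hFG).elim
        | exact ((hqp.trans hpq).not_ge hFG).elim

/-- The embedding of the original poset in its four-element extension. -/
def oldEmbedding : L ↪o FourExtension F G := ⟨⟨old, fun _ _ => old.inj⟩, old_le_old⟩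

@[simp] theorem oldEmbedding_apply (x : L) :
    (oldEmbedding x : FourExtension F G) = old x := rfl

@[simp] theorem old_lt_old {x y : L} : (old x : FourExtension F G) < old y ↔ x < y := by
  simp [lt_iff_le_not_ge]

@[simp] theorem old_lt_A {x : L} {i : Fin 2} : (old x : FourExtension F G) < A i ↔ x < F := by
  rw [lt_iff_le_not_ge, old_le_A, A_le_old, and_iff_left_of_imp]
  exact fun h h' => (h.trans_le hFG.out).asymm h'

@[simp] theorem old_lt_B {x : L} {i : Fin 2} : (old x : FourExtension F G) < B i ↔ x < F := by
  rw [lt_iff_le_not_ge, old_le_B, B_le_old, and_iff_left_of_imp]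
  exact fun h h' => (h.trans_le hFG.out).asymm h'

@[simp] theorem A_lt_old {y : L} {i : Fin 2} : (A i : FourExtension F G) < old y ↔ G < y := by
  rw [lt_iff_le_not_ge, old_le_A, A_le_old, and_iff_left_of_imp]
  exact fun h h' => (h'.trans_le hFG.out).asymm h

@[simp] theorem B_lt_old {y : L} {i : Fin 2} : (B i : FourExtension F G) < old y ↔ G < y := by
  rw [lt_iff_le_not_ge, old_le_B, B_le_old, and_iff_left_of_imp]
  exact fun h h' => (h'.trans_le hFG.out).asymm h

@[simp] theorem A_lt_A {i k : Fin 2} : (A i : FourExtension F G) < A k ↔ False := by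
  simp +contextual [lt_iff_le_not_ge]

@[simp] theorem A_lt_B {i k : Fin 2} : (A i : FourExtension F G) < B k ↔ True := by
  simp [lt_iff_le_not_ge]

@[simp] theorem B_lt_A {i k : Fin 2} : (B i : FourExtension F G) < A k ↔ False := by
  simp [lt_iff_le_not_ge]

@[simp] theorem B_lt_B {i k : Fin 2} : (B i : FourExtension F G) < B k ↔ False := by
  simp +contextual [lt_iff_le_not_ge]

variable [Fintype L] {n : ℕ} {r : L → ℕ} (h : IsEulerianRank n r)
include h

theorem rank_strictMono (hr : r G = r F + 1) :
    StrictMono (rank r : FourExtension F G → ℕ) := by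
  intro p q hpq
  rcases p with x | i | i <;> rcases q with y | k | k <;> simp at hpq <;>
    try have := h.strictMono hpq
  all_goals simp only [rank]; omega

/-- An `A` separates old elements from each `B`, and a `B` separates each `A` from old elements, so
the remaining coverings come from `L` or join an `A` to a `B`. -/
theorem rank_covBy (hr : r G = r F + 1) {p q : FourExtension F G} (hpq : p ⋖ q) :
    rank r q = rank r p + 1 := by
  obtain ⟨hlt, hno⟩ := hpq
  rcases p with x | i | i <;> rcases q with y | k | k <;> simp at hlt
  · exact h.rank_covBy ⟨hlt, fun z h1 h2 => hno (c := old z) (by simpa) (by simpa)⟩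
  · exact h.rank_covBy ⟨hlt, fun z h1 h2 => hno (c := old z) (by simpa) (by simpa)⟩
  · exact (hno (c := A 0) (by simpa) (by simp)).elim
  · exact (hno (c := B 0) (by simp) (by simpa)).elim
  · exact hr
  · exact h.rank_covBy ⟨hlt, fun z h1 h2 => hno (c := old z) (by simpa) (by simpa)⟩

theorem rank_eq_zero_of_isMin (hF : r F ≠ 0) {q : FourExtension F G} (hq : IsMin q) :
    rank r q = 0 := by
  obtain ⟨b, hb, hb0⟩ := h.exists_isBot
  have hbF : b < F := lt_of_le_of_ne (hb F) (by rintro rfl; exact hF hb0)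
  rcases q with x | i | i
  · have := hq (b := old b) (by simpa using hb x)
    rw [old_le_old] at this
    rw [rank, le_antisymm this (hb x), hb0]
  · exact (hq.not_lt (b := old b) (by simpa)).elim
  · exact (hq.not_lt (b := old b) (by simpa)).elim

/-- A `B` can be maximal only when `G` is the top of `L`, and then it has full rank. -/
theorem rank_eq_of_isMax {q : FourExtension F G} (hq : IsMax q) : rank r q = n := by
  obtain ⟨t, ht, htn⟩ := h.exists_isTop
  rcases q with x | i | i
  · have := hq (b := old t) (by simpa using ht x)
    rw [old_le_old] at this
    rw [rank, ← le_antisymm this (ht x), htn]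
  · exact (hq.not_lt (b := B 0) (by simp)).elim
  · have := hq.not_lt (b := old t)
    rw [B_lt_old] at this
    rw [rank, eq_of_le_of_not_lt (ht G) this, htn]

/-- The grading of the four-element extension of a graded poset. -/
@[reducible] def gradeBoundedOrder (hr : r G = r F + 1) (hF : r F ≠ 0) :
    GradeBoundedOrder (Fin (n + 1)) (FourExtension F G) where
  grade q := ⟨rank r q, Nat.lt_succ_of_le (rank_le h q)⟩
  grade_strictMono _ _ hpq := rank_strictMono h hr hpq
  covBy_grade p q hpq := by
    refine ⟨rank_strictMono h hr hpq.lt, fun c h1 h2 => ?_⟩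
    have := rank_covBy h hr hpq
    rw [Fin.lt_def] at h1 h2
    dsimp only at h1 h2
    omega
  isMin_grade q hq c _ := by
    rw [Fin.le_def]
    dsimp only
    rw [rank_eq_zero_of_isMin h hF hq]
    exact Nat.zero_le _
  isMax_grade q hq c _ := by
    rw [Fin.le_def]
    dsimp only
    rw [rank_eq_of_isMax h hq]
    exact Nat.le_of_lt_succ c.2

open Classical in
theorem sum_interval_eq_zero (hr : r G = r F + 1) {p q : FourExtension F G} (hpq : p < q) :
    ∑ z with p ≤ z ∧ z ≤ q, (-1 : ℤ) ^ rank r z = 0 := by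
  have hFG := hFG.out
  have hsign : (-1 : ℤ) ^ r G = -(-1) ^ r F := by rw [hr, pow_succ]; ring
  have hempty : ∀ z, ¬ (G < z ∧ z < F) := fun z hz => (hz.1.trans hz.2).not_ge hFG
  rw [Finset.sum_filter, sum_eq]
  rcases p with x | i | i <;> rcases q with y | k | k <;>
    simp only [old_lt_old, old_lt_A, old_lt_B, A_lt_old, A_lt_A, A_lt_B, B_lt_old, B_lt_A,
      B_lt_B] at hpq <;>
    simp only [old_le_old, old_le_A, old_le_B, A_le_old, A_le_A, A_le_B, B_le_old, B_le_A, B_le_B,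
      rank, hsign]
  -- Between old elements the block is present entirely or not at all, and its signs cancel.
  · rw [← Finset.sum_filter, h.sum_eq_zero hpq]
    simp only [Fin.sum_univ_two]
    split_ifs <;> ring
  · rw [← Finset.sum_filter, h.sum_Ico hpq]
    simp [hpq]
  · rw [← Finset.sum_filter, h.sum_Ico hpq]
    simp [hpq]
    ring
  · rw [← Finset.sum_filter, h.sum_Ioc hpq, hsign]
    simp [hpq]
    ring
  -- Between an `A` and a `B` there is no old element, so the interval has just its two endpoints.
  · simp [hempty]
  · rw [← Finset.sum_filter, h.sum_Ioc hpq, hsign]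
    simp [hpq]

theorem isEulerian (hr : r G = r F + 1) (hF : r F ≠ 0) :
    letI := gradeBoundedOrder h hr hF (F := F) (G := G)
    IsEulerian n (FourExtension F G) := by
  classical
  intro p q hpq
  exact (card_even_eq_card_odd_iff (fun z => z ∈ Set.Icc p q) (rank r)).2
    (sum_interval_eq_zero h hr hpq)

end FourExtension

end FourExtension

/-! ### The main theorem -/

theorem mainTheorem1 (m d j : ℕ) (hd : 3 ≤ d) (hj : j + 1 ≤ d)
    (P : Set (EuclideanSpace ℝ (Fin m))) (hP : IsPolytopeOfDim d P) :
    ∃ (Q : Type) (_ : PartialOrder Q) (_ : Finite Q)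
      (_ : GradeBoundedOrder (Fin (d + 1 + 1)) Q),
      IsEulerian (d + 1) Q ∧
      IsEmpty (Q ≃o FaceLattice P) ∧
      DiffersOnlyInDims P (d + 1) Q {(j : ℤ), (j : ℤ) + 1} ∧
      (∃ b : Q, IsBot b) ∧ (j + 1 < d → ∃ t : Q, IsTop t) ∧
      ∃ (ι : FaceLattice P ↪o Q) (F G : FaceLattice P) (A B : Fin 2 → Q),
        (∀ C, elemDim (d + 1) (ι C) = affDim C.1) ∧
        affDim F.1 = j ∧ affDim G.1 = (j : ℤ) + 1 ∧ F ≤ G ∧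
        AdjoinsFour ι F G A B ∧
        (∀ i, elemDim (d + 1) (A i) = j) ∧ (∀ l, elemDim (d + 1) (B l) = (j : ℤ) + 1) := by
  obtain ⟨_, r, h, hr⟩ := hP.exists_isEulerianRank
  -- Rank is dimension plus one, so rank `j + 1` selects a `j`-face.
  obtain ⟨F, G, hcov, hF, hG⟩ := h.exists_covBy_rank_eq (k := j + 1) (by omega)
  have : Fact (F ≤ G) := ⟨hcov.le⟩
  have hFG : r G = r F + 1 := by omega
  have hF0 : r F ≠ 0 := by omega
  let _ := FourExtension.gradeBoundedOrder (F := F) (G := G) h hFG hF0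
  have hdim : ∀ q : FourExtension F G, elemDim (d + 1) q = (FourExtension.rank r q : ℤ) - 1 :=
    fun _ => rfl
  have hold : ∀ C, elemDim (d + 1) (FourExtension.old C : FourExtension F G) = affDim C.1 :=
    fun C => by rw [hdim, FourExtension.rank, hr, add_sub_cancel_right]
  have hA : ∀ i, elemDim (d + 1) (FourExtension.A i : FourExtension F G) = j := fun i => by
    rw [hdim, FourExtension.rank, hF]; push_cast; ring
  have hB : ∀ i, elemDim (d + 1) (FourExtension.B i : FourExtension F G) = (j : ℤ) + 1 :=
    fun i => by rw [hdim, FourExtension.rank, hG]; push_cast; ring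
  refine ⟨FourExtension F G, inferInstance, inferInstance, inferInstance,
    FourExtension.isEulerian h hFG hF0, ⟨fun e => ?_⟩, ?_, ?_, fun hjd => ?_,
    FourExtension.oldEmbedding, F, G, FourExtension.A, FourExtension.B, hold, ?_, ?_, hcov.le, ⟨?_, ?_, ?_, ?_, ?_⟩, hA, hB⟩
  · have h1 := Fintype.card_congr e.toEquiv
    rw [Fintype.card_congr (FourExtension.equivSum F G)] at h1
    simp at h1
  · let f : {C : FaceLattice P // affDim C.1 ∉ ({(j : ℤ), (j : ℤ) + 1} : Set ℤ)} →
        {x : FourExtension F G // elemDim (d + 1) x ∉ ({(j : ℤ), (j : ℤ) + 1} : Set ℤ)} :=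
      fun C => ⟨.old C.1, by rw [hold]; exact C.2⟩
    have hf : Function.Bijective f := by
      refine ⟨fun C D hCD => Subtype.ext (FourExtension.old.inj (Subtype.ext_iff.1 hCD)), ?_⟩
      rintro ⟨x | i | i, hx⟩
      · exact ⟨⟨x, by rwa [hold] at hx⟩, rfl⟩
      · exact (hx (by simp [hA])).elim
      · exact (hx (by simp [hB])).elim
    exact ⟨⟨Equiv.ofBijective f hf, FourExtension.old_le_old⟩, fun C => hold C.1⟩
  · obtain ⟨b, hb, hb0⟩ := h.exists_isBot
    have hbF : b < F := lt_of_le_of_ne (hb F) (by rintro rfl; exact hF0 hb0)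
    exact ⟨.old b, fun q => by cases q <;> simp [hb _, hbF]⟩
  · obtain ⟨t, ht, htn⟩ := h.exists_isTop
    -- Since `j + 1 < d`, `G` is a proper face, so the old top lies above the block.
    have hGt : G < t := lt_of_le_of_ne (ht G) (by rintro rfl; omega)
    exact ⟨.old t, fun q => by cases q <;> simp [ht _, hGt]⟩
  · have := hr F; push_cast [hF] at this; linarith
  · have := hr G; push_cast [hG] at this; linarith
  · exact (FourExtension.equivSum F G).symm.bijective
  · rintro i (x | k | k) <;> simp [-Subtype.exists]
  · rintro i (x | k | k) <;> simp [-Subtype.exists]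
  · rintro i (x | k | k) <;> simp [-Subtype.exists]
  · rintro i (x | k | k) <;> simp [-Subtype.exists]
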